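/- Let $N\ge 1$ and $m\ge 1$ be integers, and let $x_{n,k},y_{n,k}$ ($1\le n\le N$, $1\le k\le m$) be $2Nm$ mutually independent real Gaussian random variables with mean $0$ and variance $1/2$. For real numbers $\rho_2,\dots,\rho_N$ put $$g_{1,k}=x_{1,k}+\jmath\, y_{1,k},\qquad g_{n,k}=\sqrt{1-\rho_n^2}\,x_{n,k}+\rho_n x_{1,k}+\jmath\left(\sqrt{1-\rho_n^2}\,y_{n,k}+\rho_n y_{1,k}\right)\quad(2\le n\le N),$$ let $\hat h_n=\sum_{k=1}^m|g_{n,k}|^2$ be the estimated gain of port $n$ (so that the $\sqrt{\hat h_n}$ are correlated Nakagami-$m$ envelopes), and let $\hat h=\max\{\hat h_1,\dots,\hat h_N\}$. For $a>0$ and $b\ge 0$ let $$Q_m(a,b)=\int_b^\infty t\left(\frac ta\right)^{m-1}e^{-(t^2+a^2)/2}\,I_{m-1}(at)\,dt$$ be the generalized Marcum $Q$-function, where $I_{m-1}$ is the modified Bessel function of the first kind, and let $Q_m(0,b)=\Gamma(m,b^2/2)/\Gamma(m)$ be its limit as $a\to0$, where $\Gamma(\cdot,\cdot)$ is the upper incomplete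 gamma function. (i) If $|\rho_n|<1$ for $n=2,\dots,N$, then the cumulative distribution function of $\hat h$ is $F_{\hat h}(x)=0$ for $x<0$ and $$F_{\hat h}(x)=\frac1{\Gamma(m)}\int_0^x e^{-z}z^{m-1}\prod_{n=2}^N\phi_n(z,x)\,dz\qquad(x\ge 0),$$ where $$\phi_n(z,x)=1-Q_m\left(\sqrt{\frac{2z\rho_n^2}{1-\rho_n^2}},\sqrt{\frac{2x}{1-\rho_n^2}}\right).$$ (ii) In particular, if $\rho_n=J_0(2\pi d_n/\lambda)$, where $J_0$ is the Bessel function of the first kind of order $0$, $\lambda>0$ is the wavelength and $d_n>0$ is the displacement of port $n$ from port $1$ ($n=2,\dots,N$), then $|\rho_n|<1$ for $n=2,\dots,N$ and the formula in (i) holds. -/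

import Mathlib

open MeasureTheory ProbabilityTheory

namespace FluidAntenna

noncomputable section

/-- Bessel function of the first kind of integer order `n`, by its power series. -/
def besselJ (n : ℕ) (x : ℝ) : ℝ :=
  ∑' k : ℕ, (-1 : ℝ) ^ k / ((k.factorial : ℝ) * ((k + n).factorial : ℝ)) * (x / 2) ^ (2 * k + n)

/-- Modified Bessel function of the first kind of integer order `n`, by its power series. -/
def besselI (n : ℕ) (x : ℝ) : ℝ :=
  ∑' k : ℕ, 1 / ((k.factorial : ℝ) * ((k + n).factorial : ℝ)) * (x / 2) ^ (2 * k + n)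

/-- Upper incomplete gamma function `Γ(m, b) = ∫_b^∞ t^(m-1) e^(-t) dt` of integer order `m ≥ 1`. -/
def upperGamma (m : ℕ) (b : ℝ) : ℝ :=
  ∫ t in Set.Ioi b, t ^ (m - 1) * Real.exp (-t)

/-- Generalized Marcum Q-function of integer order `m ≥ 1`, for `a, b ≥ 0`:
`Q_m(a, b) = ∫_b^∞ t (t/a)^(m-1) exp(-(t² + a²)/2) I_{m-1}(a t) dt`,
where at `a = 0` the integral formula is read as its limit `Γ(m, b²/2) / Γ(m)`. -/
def marcumQ (m : ℕ) (a b : ℝ) : ℝ :=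
  if a = 0 then upperGamma m (b ^ 2 / 2) / Real.Gamma m
  else ∫ t in Set.Ioi b,
    t * (t / a) ^ (m - 1) * Real.exp (-(t ^ 2 + a ^ 2) / 2) * besselI (m - 1) (a * t)

/-- `φ(z, x) = 1 - Q_m(√(2 z ρ² / (1 - ρ²)), √(2 x / (1 - ρ²)))`. -/
def phi (m : ℕ) (ρ z x : ℝ) : ℝ :=
  1 - marcumQ m (Real.sqrt (2 * z * ρ ^ 2 / (1 - ρ ^ 2))) (Real.sqrt (2 * x / (1 - ρ ^ 2)))

/-- Correlation coefficient `J₀(2 π d / lam)` of a port at displacement `d` from the reference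
port, for wavelength `lam`. -/
def portCorrelation (lam d : ℝ) : ℝ := besselJ 0 (2 * Real.pi * (d / lam))

variable {Ω : Type*} {N m : ℕ} [NeZero N]

/-- The complex Gaussian variable `g_{n,k}` (with `σ = 1`). The ports are indexed by `Fin N`
and the reference port is `0`; the value of `ρ` at the reference port is irrelevant. -/
def channel (ρ : Fin N → ℝ) (X Y : Fin N → Fin m → Ω → ℝ) (n : Fin N) (k : Fin m) (ω : Ω) : ℂ :=
  if n = 0 then
    (X 0 k ω : ℂ) + Complex.I * (Y 0 k ω : ℂ)
  else
    ((Real.sqrt (1 - ρ n ^ 2) * X n k ω + ρ n * X 0 k ω : ℝ) : ℂ)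
      + Complex.I * ((Real.sqrt (1 - ρ n ^ 2) * Y n k ω + ρ n * Y 0 k ω : ℝ) : ℂ)

/-- The gain of port `n`: `∑ₖ |g_{n,k}|²`. -/
def portGain (ρ : Fin N → ℝ) (X Y : Fin N → Fin m → Ω → ℝ) (n : Fin N) (ω : Ω) : ℝ :=
  ∑ k : Fin m, ‖channel ρ X Y n k ω‖ ^ 2

/-- The gain of the best port. -/
def bestGain (ρ : Fin N → ℝ) (X Y : Fin N → Fin m → Ω → ℝ) (ω : Ω) : ℝ :=
  Finset.univ.sup' ⟨0, Finset.mem_univ _⟩ (fun n : Fin N => portGain ρ X Y n ω)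

end

end FluidAntenna

/-!
The sum of squares of independent Gaussian variables with common variance `v`, divided by `2 v`, has
a noncentral gamma law, that is, a Poisson mixture of gamma laws: the two Laplace transforms agree
near `0`, since multiplying a Gaussian, gamma or Poisson density by an exponential gives a constant
times a density of the same family. Integrating the mixture density after the substitution
`h = t² / 2` produces the power series of `I_{m-1}`, so the Marcum Q-function is the tail of this
law.

Conditionally on the coordinates of the reference port, the gains of the other ports are independent
and, after division by `1 - ρₙ²`, have noncentral gamma laws whose noncentrality depends on these
coordinates only through the reference gain, which is itself gamma distributed. Integrating the
product of the conditional distribution functions against that gamma law gives the formula.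

For `x ≠ 0` the bound `|J₀(x)| < 1` follows from `π J₀(x) = ∫₀^π cos (x sin θ) dθ`, whose integrand
is continuous, takes values in `[-1, 1]` and is constantly equal to neither `1` nor `-1`.
-/

namespace FluidAntenna

open scoped NNReal ENNReal

open Filter Complex in
theorem measure_ext_of_lintegral_exp_mul {μ ν : Measure ℝ} [IsFiniteMeasure μ]
    [IsFiniteMeasure ν]
    (hfin : ∀ᶠ t in nhds (0 : ℝ), ∫⁻ x, ENNReal.ofReal (Real.exp (t * x)) ∂μ ≠ ⊤)
    (heq : ∀ᶠ t in nhds (0 : ℝ), ∫⁻ x, ENNReal.ofReal (Real.exp (t * x)) ∂μ =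
      ∫⁻ x, ENNReal.ofReal (Real.exp (t * x)) ∂ν) : μ = ν := by
  have zero_mem {κ : Measure ℝ}
      (h : ∀ᶠ t in nhds (0 : ℝ), ∫⁻ x, ENNReal.ofReal (Real.exp (t * x)) ∂κ ≠ ⊤) :
      0 ∈ interior (integrableExpSet id κ) :=
    mem_interior_iff_mem_nhds.mpr <| h.mono fun t ht =>
      (lintegral_ofReal_ne_top_iff_integrable (by fun_prop)
        (ae_of_all _ fun x => (Real.exp_pos _).le)).mp ht
  have hμ := zero_mem hfin
  have hν := zero_mem (κ := ν) <| by
    filter_upwards [hfin, heq] with t ht h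
    rwa [← h]
  have hmgf : ∀ᶠ t : ℝ in nhds 0, complexMGF id μ t = complexMGF id ν t := by
    filter_upwards [heq] with t ht
    simp only [complexMGF_ofReal, mgf, id]
    rw [integral_eq_lintegral_of_nonneg_ae (ae_of_all _ fun x => (Real.exp_pos _).le)
      (by fun_prop), integral_eq_lintegral_of_nonneg_ae
      (ae_of_all _ fun x => (Real.exp_pos _).le) (by fun_prop), ht]
  have hstrip : Set.EqOn (complexMGF id μ) (complexMGF id ν)
      {z | z.re ∈ interior (integrableExpSet id μ) ∩ interior (integrableExpSet id ν)} := by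
    refine AnalyticOnNhd.eqOn_of_preconnected_of_frequently_eq (z₀ := 0)
      (analyticOnNhd_complexMGF.mono fun z hz => hz.1)
      (analyticOnNhd_complexMGF.mono fun z hz => hz.2)
      ((convex_integrableExpSet.interior.inter
        convex_integrableExpSet.interior).linear_preimage reLm).isPreconnected ⟨hμ, hν⟩ ?_
    have hreal : Tendsto (fun t : ℝ => (t : ℂ)) (nhdsWithin 0 {0}ᶜ) (nhdsWithin 0 {0}ᶜ) :=
      tendsto_nhdsWithin_iff.mpr ⟨(continuous_ofReal.tendsto' 0 0 ofReal_zero).mono_left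
        nhdsWithin_le_nhds, eventually_mem_nhdsWithin.mono fun t ht => by simpa using ht⟩
    exact hreal.frequently (hmgf.filter_mono nhdsWithin_le_nhds).frequently
  refine Measure.ext_of_charFun (funext fun t => ?_)
  rw [← complexMGF_id_mul_I, ← complexMGF_id_mul_I]
  exact hstrip ⟨by simpa using hμ, by simpa using hν⟩

theorem measurable_gammaPDF (a r : ℝ) : Measurable (gammaPDF a r) :=
  (measurable_gammaPDFReal a r).ennreal_ofReal

theorem lintegral_exp_mul_gammaMeasure {a r t : ℝ} (ha : 0 < a) (hr : 0 < r) (ht : t < r) :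
    ∫⁻ x, ENNReal.ofReal (Real.exp (t * x)) ∂gammaMeasure a r =
      ENNReal.ofReal ((r / (r - t)) ^ a) := by
  have hrt : 0 < r - t := sub_pos.mpr ht
  have htilt (x : ℝ) : gammaPDF a r x * ENNReal.ofReal (Real.exp (t * x)) =
      ENNReal.ofReal ((r / (r - t)) ^ a) * gammaPDF a (r - t) x := by
    rw [gammaPDF, gammaPDF, ← ENNReal.ofReal_mul (gammaPDFReal_nonneg ha hr x),
      ← ENNReal.ofReal_mul (by positivity), gammaPDFReal, gammaPDFReal]
    split_ifs
    · rw [Real.div_rpow hr.le hrt.le, show -((r - t) * x) = -(r * x) + t * x by ring, Real.exp_add]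
      field_simp
    · simp
  rw [gammaMeasure, lintegral_withDensity_eq_lintegral_mul _ (measurable_gammaPDF a r)
    (by fun_prop)]
  simp_rw [Pi.mul_apply, htilt]
  rw [lintegral_const_mul _ (measurable_gammaPDF _ _), lintegral_gammaPDF_eq_one ha hrt,
    mul_one]

theorem lintegral_poissonMeasure (lam : ℝ≥0) (f : ℕ → ℝ≥0∞) :
    ∫⁻ k, f k ∂poissonMeasure lam =
      ∑' k, ENNReal.ofReal (Real.exp (-lam) * lam ^ k / k.factorial) * f k := by
  simp [poissonMeasure, lintegral_sum_measure]

theorem lintegral_pow_poissonMeasure (lam s : ℝ≥0) :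
    ∫⁻ k, (s : ℝ≥0∞) ^ k ∂poissonMeasure lam = ENNReal.ofReal (Real.exp (lam * (s - 1))) := by
  have htilt (k : ℕ) : ENNReal.ofReal (Real.exp (-lam) * lam ^ k / k.factorial) * s ^ k =
      ENNReal.ofReal (Real.exp (lam * (s - 1))) *
        ENNReal.ofReal (Real.exp (-(lam * s : ℝ≥0)) * (lam * s : ℝ≥0) ^ k / k.factorial) := by
    rw [← ENNReal.ofReal_coe_nnreal, ← ENNReal.ofReal_pow s.coe_nonneg,
      ← ENNReal.ofReal_mul (by positivity), ← ENNReal.ofReal_mul (by positivity)]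
    congr 1
    push_cast
    rw [show -(lam : ℝ) = lam * (s - 1) + -(lam * s) by ring, Real.exp_add]
    ring
  have htotal := lintegral_poissonMeasure (lam * s) 1
  simp only [Pi.one_apply, lintegral_one, measure_univ, mul_one] at htotal
  rw [lintegral_poissonMeasure]
  simp_rw [htilt]
  rw [ENNReal.tsum_mul_left, ← htotal, mul_one]

theorem lintegral_exp_mul_sq_gaussianReal (c : ℝ) {v : ℝ≥0} (hv : v ≠ 0) {t : ℝ} (ht : t < 1) :
    ∫⁻ x, ENNReal.ofReal (Real.exp (t * (x ^ 2 / (2 * v)))) ∂gaussianReal c v =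
      ENNReal.ofReal ((√(1 - t))⁻¹ * Real.exp (c ^ 2 / (2 * v) * (t / (1 - t)))) := by
  have : (0 : ℝ) < v := by positivity
  have ht' : 0 < 1 - t := sub_pos.mpr ht
  obtain ⟨s, hs⟩ : ∃ s : ℝ≥0, (s : ℝ) = 1 - t := ⟨⟨1 - t, ht'.le⟩, rfl⟩
  have hs₀ : s ≠ 0 := fun h => ht'.ne' (by rw [← hs, h, NNReal.coe_zero])
  have htilt (x : ℝ) : gaussianPDF c v x * ENNReal.ofReal (Real.exp (t * (x ^ 2 / (2 * v)))) =
      ENNReal.ofReal ((√(1 - t))⁻¹ * Real.exp (c ^ 2 / (2 * v) * (t / (1 - t)))) *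
        gaussianPDF (c / (1 - t)) (v / s) x := by
    rw [gaussianPDF, gaussianPDF, ← ENNReal.ofReal_mul (gaussianPDFReal_nonneg _ _ _),
      ← ENNReal.ofReal_mul (by positivity), gaussianPDFReal, gaussianPDFReal]
    have hexp : -(x - c) ^ 2 / (2 * v) + t * (x ^ 2 / (2 * v)) =
        c ^ 2 / (2 * v) * (t / (1 - t)) + -(x - c / (1 - t)) ^ 2 / (2 * (v / (1 - t))) := by
      field_simp
      ring
    have hsqrt : √(2 * Real.pi * v) = √(1 - t) * √(2 * Real.pi * (v / (1 - t))) := by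
      rw [← Real.sqrt_mul ht'.le]
      congr 1
      field_simp
    rw [mul_assoc, ← Real.exp_add, hexp, Real.exp_add, hsqrt, mul_inv,
      NNReal.coe_div, hs]
    congr 1
    ring
  rw [gaussianReal_of_var_ne_zero c hv, lintegral_withDensity_eq_lintegral_mul _
    (measurable_gaussianPDF c v) (by fun_prop)]
  simp_rw [Pi.mul_apply, htilt]
  rw [lintegral_const_mul _ (measurable_gaussianPDF _ _),
    lintegral_gaussianPDF_eq_one _ (div_ne_zero hv hs₀), mul_one]

/-- The noncentral gamma distribution of shape `a`, noncentrality `lam` and unit rate, as a Poisson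
mixture of gamma distributions. With `a = ν / 2` it is the law of half a noncentral chi-squared
variable with `ν` degrees of freedom and noncentrality parameter `2 lam`. -/
noncomputable def noncentralGamma (a : ℝ) (lam : ℝ≥0) : Measure ℝ :=
  (poissonMeasure lam).bind fun k => gammaMeasure (a + k) 1

theorem noncentralGamma_apply (a : ℝ) (lam : ℝ≥0) {s : Set ℝ} (hs : MeasurableSet s) :
    noncentralGamma a lam s = ∫⁻ k, gammaMeasure (a + k) 1 s ∂poissonMeasure lam :=
  Measure.bind_apply hs Measurable.of_discrete.aemeasurable

theorem measurable_noncentralGamma_apply (a : ℝ) {s : Set ℝ} (hs : MeasurableSet s) :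
    Measurable fun lam => noncentralGamma a lam s := by
  simp_rw [noncentralGamma_apply a _ hs, lintegral_poissonMeasure]
  fun_prop

theorem isProbabilityMeasure_noncentralGamma {a : ℝ} (ha : 0 < a) (lam : ℝ≥0) :
    IsProbabilityMeasure (noncentralGamma a lam) :=
  isProbabilityMeasure_bind Measurable.of_discrete.aemeasurable <| ae_of_all _ fun k =>
    isProbabilityMeasure_gammaMeasure (by positivity) one_pos

theorem noncentralGamma_zero (a : ℝ) : noncentralGamma a 0 = gammaMeasure a 1 := by
  ext s hs
  rw [noncentralGamma_apply a 0 hs, lintegral_poissonMeasure, tsum_eq_single 0]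
  · simp
  · intro k hk
    simp [hk]

theorem lintegral_exp_mul_noncentralGamma {a t : ℝ} (ha : 0 < a) (lam : ℝ≥0) (ht : t < 1) :
    ∫⁻ x, ENNReal.ofReal (Real.exp (t * x)) ∂noncentralGamma a lam =
      ENNReal.ofReal ((1 / (1 - t)) ^ a * Real.exp (lam * (t / (1 - t)))) := by
  have ht' : 0 < 1 - t := sub_pos.mpr ht
  obtain ⟨s, hs⟩ : ∃ s : ℝ≥0, (s : ℝ) = 1 / (1 - t) := ⟨⟨1 / (1 - t), by positivity⟩, rfl⟩
  have hs' : (0 : ℝ) < s := by rw [hs]; positivity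
  have hgamma (k : ℕ) : ∫⁻ x, ENNReal.ofReal (Real.exp (t * x)) ∂gammaMeasure (a + k) 1 =
      ENNReal.ofReal (s ^ a) * (s : ℝ≥0∞) ^ k := by
    rw [lintegral_exp_mul_gammaMeasure (by positivity) one_pos ht, ← hs, Real.rpow_add hs',
      Real.rpow_natCast, ENNReal.ofReal_mul (by positivity), ENNReal.ofReal_pow s.coe_nonneg,
      ENNReal.ofReal_coe_nnreal]
  have hexp : (s : ℝ) - 1 = t / (1 - t) := by
    rw [hs]
    field_simp
    ring
  rw [noncentralGamma, Measure.lintegral_bind Measurable.of_discrete.aemeasurable (by fun_prop)]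
  simp_rw [hgamma]
  rw [lintegral_const_mul _ .of_discrete, lintegral_pow_poissonMeasure,
    ← ENNReal.ofReal_mul (by positivity), hexp, hs]

section SumOfSquares

variable {ι : Type*} [Fintype ι]

theorem lintegral_exp_mul_sum_sq_gaussianReal (c : ι → ℝ) {v : ℝ≥0} (hv : v ≠ 0) {t : ℝ}
    (ht : t < 1) :
    ∫⁻ w, ENNReal.ofReal (Real.exp (t * ((∑ i, w i ^ 2) / (2 * v))))
        ∂Measure.pi (fun i => gaussianReal (c i) v) =
      ENNReal.ofReal ((1 / (1 - t)) ^ (Fintype.card ι / 2 : ℝ) *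
        Real.exp ((∑ i, c i ^ 2) / (2 * v) * (t / (1 - t)))) := by
  have : 0 < 1 - t := sub_pos.mpr ht
  have hprod (w : ι → ℝ) : ENNReal.ofReal (Real.exp (t * ((∑ i, w i ^ 2) / (2 * v)))) =
      ∏ i, ENNReal.ofReal (Real.exp (t * (w i ^ 2 / (2 * v)))) := by
    rw [Finset.sum_div, Finset.mul_sum, Real.exp_sum,
      ENNReal.ofReal_prod_of_nonneg fun i _ => (Real.exp_pos _).le]
  have hindep := iIndepFun_pi (μ := fun i => gaussianReal (c i) v)
    (X := fun _ x => ENNReal.ofReal (Real.exp (t * (x ^ 2 / (2 * v))))) fun i => by fun_prop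
  have hcoord (i : ι) := (measurePreserving_eval (fun i => gaussianReal (c i) v) i).lintegral_comp
    (f := fun x => ENNReal.ofReal (Real.exp (t * (x ^ 2 / (2 * v))))) (by fun_prop)
  have hpow : (√(1 - t))⁻¹ ^ Fintype.card ι = (1 / (1 - t)) ^ (Fintype.card ι / 2 : ℝ) := by
    rw [← Real.sqrt_inv, ← one_div, Real.sqrt_eq_rpow, ← Real.rpow_mul_natCast (by positivity)]
    ring_nf
  simp_rw [hprod]
  rw [lintegral_prod_eq_prod_lintegral_of_indepFun Finset.univ _ hindep fun i => by fun_prop]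
  simp only [Function.eval] at hcoord
  simp_rw [hcoord, lintegral_exp_mul_sq_gaussianReal _ hv ht]
  rw [← ENNReal.ofReal_prod_of_nonneg fun i _ => by positivity, Finset.prod_mul_distrib,
    Finset.prod_const, Finset.card_univ, hpow, ← Real.exp_sum, ← Finset.sum_mul, Finset.sum_div]

theorem map_sum_sq_pi_gaussianReal [Nonempty ι] (c : ι → ℝ) {v : ℝ≥0} (hv : v ≠ 0) :
    (Measure.pi fun i => gaussianReal (c i) v).map (fun w => (∑ i, w i ^ 2) / (2 * v : ℝ)) =
      noncentralGamma (Fintype.card ι / 2) ((∑ i, c i ^ 2) / (2 * v)).toNNReal := by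
  have hshape : (0 : ℝ) < Fintype.card ι / 2 := by positivity
  have hlam : 0 ≤ (∑ i, c i ^ 2) / (2 * v) := by positivity
  have := isProbabilityMeasure_noncentralGamma hshape ((∑ i, c i ^ 2) / (2 * v)).toNNReal
  refine (measure_ext_of_lintegral_exp_mul ?_ ?_).symm <;>
    filter_upwards [Iio_mem_nhds (one_pos : (0 : ℝ) < 1)] with t ht
  · rw [lintegral_exp_mul_noncentralGamma hshape _ ht]
    exact ENNReal.ofReal_ne_top
  · rw [lintegral_map (by fun_prop) (by fun_prop), lintegral_exp_mul_sum_sq_gaussianReal c hv ht,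
      lintegral_exp_mul_noncentralGamma hshape _ ht, Real.coe_toNNReal _ hlam]

end SumOfSquares

theorem lintegral_Ioi_sq_div_two {b : ℝ} (hb : 0 ≤ b) (f : ℝ → ℝ≥0∞) :
    ∫⁻ h in Set.Ioi (b ^ 2 / 2), f h = ∫⁻ t in Set.Ioi b, ENNReal.ofReal t * f (t ^ 2 / 2) := by
  have himage : (fun t : ℝ => t ^ 2 / 2) '' Set.Ioi b = Set.Ioi (b ^ 2 / 2) := by
    ext h
    simp only [Set.mem_image, Set.mem_Ioi]
    refine ⟨fun ⟨t, ht, hth⟩ => hth ▸ by gcongr, fun hh => ⟨√(2 * h), ?_, ?_⟩⟩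
    · exact (Real.lt_sqrt hb).mpr (by linarith)
    · rw [Real.sq_sqrt (by linarith [sq_nonneg b])]
      ring
  rw [← himage, lintegral_image_eq_lintegral_deriv_mul_of_monotoneOn measurableSet_Ioi
    (f' := fun t => t)]
  · intro t _
    simpa using ((hasDerivAt_pow 2 t).div_const 2).hasDerivWithinAt
  · intro s hs t _ hst
    have : 0 ≤ s := hb.trans (le_of_lt hs)
    simp only
    gcongr

/-- The density of `noncentralGamma a lam`, as a Poisson mixture of gamma densities; its terms are
those of the power series of the modified Bessel function in the Marcum Q-function. -/
noncomputable def noncentralGammaPDF (a : ℝ) (lam : ℝ≥0) (x : ℝ) : ℝ≥0∞ :=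
  ∫⁻ k, gammaPDF (a + k) 1 x ∂poissonMeasure lam

theorem measurable_noncentralGammaPDF (a : ℝ) (lam : ℝ≥0) :
    Measurable (noncentralGammaPDF a lam) := by
  unfold noncentralGammaPDF
  simp_rw [lintegral_poissonMeasure]
  exact .tsum fun k => (measurable_gammaPDF _ _).const_mul _

theorem noncentralGamma_eq_withDensity (a : ℝ) (lam : ℝ≥0) :
    noncentralGamma a lam = volume.withDensity (noncentralGammaPDF a lam) := by
  ext s hs
  rw [noncentralGamma_apply a lam hs, withDensity_apply _ hs]
  simp_rw [gammaMeasure, withDensity_apply _ hs, noncentralGammaPDF, lintegral_poissonMeasure]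
  rw [lintegral_tsum fun k => ((measurable_gammaPDF _ _).const_mul _).aemeasurable]
  simp_rw [lintegral_const_mul _ (measurable_gammaPDF _ _)]

theorem gammaPDFReal_natCast_one {m : ℕ} (hm : 1 ≤ m) {x : ℝ} (hx : 0 ≤ x) :
    gammaPDFReal m 1 x = 1 / Real.Gamma m * (Real.exp (-x) * x ^ (m - 1)) := by
  rw [gammaPDFReal, if_pos hx, Real.one_rpow, one_mul, ← Nat.cast_pred hm, Real.rpow_natCast]
  ring

theorem setIntegral_gammaMeasure {a r : ℝ} (ha : 0 < a) (hr : 0 < r) (f : ℝ → ℝ) {s : Set ℝ}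
    (hs : MeasurableSet s) :
    ∫ x in s, f x ∂gammaMeasure a r = ∫ x in s, gammaPDFReal a r x * f x := by
  rw [gammaMeasure, setIntegral_withDensity_eq_setIntegral_toReal_smul (measurable_gammaPDF a r)
    (ae_of_all _ fun x => ENNReal.ofReal_lt_top) _ hs]
  simp_rw [gammaPDF, ENNReal.toReal_ofReal (gammaPDFReal_nonneg ha hr _), smul_eq_mul]

theorem setIntegral_Iic_gammaMeasure_natCast_one {m : ℕ} (hm : 1 ≤ m) (f : ℝ → ℝ)
    {x : ℝ} (hx : 0 ≤ x) :
    ∫ z in Set.Iic x, f z ∂gammaMeasure m 1 =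
      1 / Real.Gamma m * ∫ z in (0 : ℝ)..x, Real.exp (-z) * z ^ (m - 1) * f z := by
  have hsupp : ∀ z ∈ Set.Iic x \ Set.Icc 0 x, gammaPDFReal m 1 z * f z = 0 := by
    rintro z ⟨hzx, hz⟩
    rw [gammaPDFReal, if_neg fun hz0 => hz ⟨hz0, hzx⟩, zero_mul]
  rw [setIntegral_gammaMeasure (Nat.cast_pos.mpr hm) one_pos f measurableSet_Iic,
    setIntegral_eq_of_subset_of_forall_sdiff_eq_zero measurableSet_Iic Set.Icc_subset_Iic_self
      hsupp, integral_Icc_eq_integral_Ioc, intervalIntegral.integral_of_le hx, ← integral_const_mul]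
  refine setIntegral_congr_fun measurableSet_Ioc fun z hz => ?_
  simp only [gammaPDFReal_natCast_one hm hz.1.le]
  ring

theorem gammaMeasure_real_Ioi {m : ℕ} (hm : 1 ≤ m) {b : ℝ} (hb : 0 ≤ b) :
    (gammaMeasure m 1).real (Set.Ioi b) = upperGamma m b / Real.Gamma m := by
  have h := setIntegral_gammaMeasure (Nat.cast_pos.mpr hm) one_pos (fun _ => 1)
    (measurableSet_Ioi (a := b))
  rw [setIntegral_const, smul_eq_mul, mul_one] at h
  rw [h, upperGamma, ← integral_div]
  refine setIntegral_congr_fun measurableSet_Ioi fun x hx => ?_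
  simp only [mul_one, gammaPDFReal_natCast_one hm (hb.trans (le_of_lt hx))]
  ring

theorem mul_toReal_noncentralGammaPDF {m : ℕ} (hm : 1 ≤ m) {a : ℝ} (ha : a ≠ 0) (t : ℝ) :
    t * (noncentralGammaPDF m (a ^ 2 / 2).toNNReal (t ^ 2 / 2)).toReal =
      t * (t / a) ^ (m - 1) * Real.exp (-(t ^ 2 + a ^ 2) / 2) * besselI (m - 1) (a * t) := by
  obtain ⟨n, rfl⟩ : ∃ n, m = n + 1 := ⟨m - 1, by omega⟩
  have hterm (k : ℕ) :
      (ENNReal.ofReal (Real.exp (-(a ^ 2 / 2)) * (a ^ 2 / 2) ^ k / k.factorial) *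
        gammaPDF ((n + 1 : ℕ) + k) 1 (t ^ 2 / 2)).toReal =
      (t / a) ^ n * Real.exp (-(t ^ 2 + a ^ 2) / 2) *
        (1 / ((k.factorial : ℝ) * ((k + n).factorial : ℝ)) * (a * t / 2) ^ (2 * k + n)) := by
    have hexp : Real.exp (-(t ^ 2 + a ^ 2) / 2) =
        Real.exp (-(a ^ 2 / 2)) * Real.exp (-(t ^ 2 / 2)) := by
      rw [← Real.exp_add]
      ring_nf
    have hpow : (t / a) ^ n * (a * t / 2) ^ (2 * k + n) =
        (a ^ 2 / 2) ^ k * (t ^ 2 / 2) ^ (k + n) := by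
      rw [pow_add, pow_add, pow_mul, mul_left_comm, ← mul_pow, ← mul_assoc, ← mul_pow]
      congr 2 <;> field_simp
    rw [ENNReal.toReal_mul, ENNReal.toReal_ofReal (by positivity), gammaPDF,
      ENNReal.toReal_ofReal (gammaPDFReal_nonneg (by positivity) one_pos _), ← Nat.cast_add,
      gammaPDFReal_natCast_one (by omega) (by positivity), show n + 1 + k = k + n + 1 by ring,
      Nat.add_sub_cancel, Nat.cast_succ (k + n), Real.Gamma_nat_eq_factorial, hexp]
    linear_combination (-(Real.exp (-(a ^ 2 / 2)) * Real.exp (-(t ^ 2 / 2)) /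
      ((k.factorial : ℝ) * ((k + n).factorial : ℝ)))) * hpow
  rw [noncentralGammaPDF, lintegral_poissonMeasure, Real.coe_toNNReal _ (by positivity),
    ENNReal.tsum_toReal_eq fun k => ENNReal.mul_ne_top ENNReal.ofReal_ne_top (by simp [gammaPDF]),
    Nat.add_sub_cancel, besselI]
  simp_rw [hterm]
  rw [tsum_mul_left]
  ring

theorem marcumQ_eq_noncentralGamma_real_Ioi {m : ℕ} (hm : 1 ≤ m) (a : ℝ) {b : ℝ} (hb : 0 ≤ b) :
    marcumQ m a b = (noncentralGamma m (a ^ 2 / 2).toNNReal).real (Set.Ioi (b ^ 2 / 2)) := by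
  rcases eq_or_ne a 0 with rfl | ha
  · rw [marcumQ, if_pos rfl, ← gammaMeasure_real_Ioi hm (by positivity), ← noncentralGamma_zero]
    simp
  have := isProbabilityMeasure_noncentralGamma (Nat.cast_pos.mpr hm) (a ^ 2 / 2).toNNReal
  have htail : noncentralGamma m (a ^ 2 / 2).toNNReal (Set.Ioi (b ^ 2 / 2)) =
      ∫⁻ t in Set.Ioi b, ENNReal.ofReal t *
        noncentralGammaPDF m (a ^ 2 / 2).toNNReal (t ^ 2 / 2) := by
    rw [noncentralGamma_eq_withDensity, withDensity_apply _ measurableSet_Ioi,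
      lintegral_Ioi_sq_div_two hb]
  have hmeas : Measurable fun t : ℝ => ENNReal.ofReal t *
      noncentralGammaPDF m (a ^ 2 / 2).toNNReal (t ^ 2 / 2) := by
    have := measurable_noncentralGammaPDF m (a ^ 2 / 2).toNNReal
    fun_prop
  rw [measureReal_def, htail, ← integral_toReal hmeas.aemeasurable
    (ae_lt_top hmeas (htail ▸ measure_ne_top _ _)), marcumQ, if_neg ha]
  refine setIntegral_congr_fun measurableSet_Ioi fun t ht => ?_
  rw [ENNReal.toReal_mul, ENNReal.toReal_ofReal (hb.trans (le_of_lt ht)),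
    mul_toReal_noncentralGammaPDF hm ha]

theorem phi_eq_noncentralGamma_real_Iic {m : ℕ} (hm : 1 ≤ m) {ρ z x : ℝ} (hρ : |ρ| < 1)
    (hz : 0 ≤ z) (hx : 0 ≤ x) :
    phi m ρ z x =
      (noncentralGamma m (z * ρ ^ 2 / (1 - ρ ^ 2)).toNNReal).real (Set.Iic (x / (1 - ρ ^ 2))) := by
  have hρ' : 0 < 1 - ρ ^ 2 := sub_pos.mpr ((sq_lt_one_iff_abs_lt_one ρ).mpr hρ)
  have := isProbabilityMeasure_noncentralGamma (Nat.cast_pos.mpr hm)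
    (z * ρ ^ 2 / (1 - ρ ^ 2)).toNNReal
  rw [phi, marcumQ_eq_noncentralGamma_real_Ioi hm _ (Real.sqrt_nonneg _),
    Real.sq_sqrt (by positivity), Real.sq_sqrt (by positivity),
    show 2 * z * ρ ^ 2 / (1 - ρ ^ 2) / 2 = z * ρ ^ 2 / (1 - ρ ^ 2) by ring,
    show 2 * x / (1 - ρ ^ 2) / 2 = x / (1 - ρ ^ 2) by ring,
    ← Set.compl_Iic, probReal_compl_eq_one_sub measurableSet_Iic, sub_sub_cancel]

theorem prod_range_odd_div_even (k : ℕ) :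
    ∏ i ∈ Finset.range k, (2 * (i : ℝ) + 1) / (2 * i + 2) =
      ((2 * k).factorial : ℝ) / (4 ^ k * (k.factorial : ℝ) ^ 2) := by
  induction k with
  | zero => simp
  | succ k ih =>
    rw [Finset.prod_range_succ, ih, show 2 * (k + 1) = 2 * k + 1 + 1 by ring,
      Nat.factorial_succ, Nat.factorial_succ, Nat.factorial_succ k]
    push_cast
    field_simp
    ring

theorem hasSum_integral_cos_mul_sin (x : ℝ) :
    HasSum (fun k : ℕ => ∫ θ in (0 : ℝ)..Real.pi,
      (-1) ^ k * (x * Real.sin θ) ^ (2 * k) / ((2 * k).factorial : ℝ))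
      (∫ θ in (0 : ℝ)..Real.pi, Real.cos (x * Real.sin θ)) := by
  refine intervalIntegral.hasSum_integral_of_dominated_convergence
    (fun k _ => |x| ^ (2 * k) / ((2 * k).factorial : ℝ)) (fun k => by fun_prop)
    (fun k => ae_of_all _ fun θ _ => ?_)
    (ae_of_all _ fun θ _ => (Real.hasSum_cosh |x|).summable) intervalIntegrable_const
    (ae_of_all _ fun θ _ => Real.hasSum_cos _)
  rw [norm_div, norm_mul, norm_pow, norm_neg, norm_one, one_pow, one_mul, norm_pow,
    Real.norm_natCast, Real.norm_eq_abs, abs_mul]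
  gcongr
  exact mul_le_of_le_one_right (abs_nonneg _) (Real.abs_sin_le_one θ)

theorem pi_mul_besselJ_zero (x : ℝ) :
    Real.pi * besselJ 0 x = ∫ θ in (0 : ℝ)..Real.pi, Real.cos (x * Real.sin θ) := by
  rw [← (hasSum_integral_cos_mul_sin x).tsum_eq, besselJ, ← tsum_mul_left]
  refine tsum_congr fun k => ?_
  have hterm (θ : ℝ) : (-1) ^ k * (x * Real.sin θ) ^ (2 * k) / ((2 * k).factorial : ℝ) =
      (-1) ^ k * x ^ (2 * k) / ((2 * k).factorial : ℝ) * Real.sin θ ^ (2 * k) := by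
    rw [mul_pow]
    ring
  simp_rw [hterm]
  rw [intervalIntegral.integral_const_mul, integral_sin_pow_even, prod_range_odd_div_even,
    add_zero, add_zero, div_pow, pow_mul 2 2 k, show (2 : ℝ) ^ 2 = 4 by norm_num]
  field_simp

theorem exists_cos_mul_sin_lt_one {x : ℝ} (hx : x ≠ 0) :
    ∃ θ ∈ Set.Icc 0 Real.pi, Real.cos (x * Real.sin θ) < 1 := by
  have hpos : 0 < min 1 (1 / |x|) := by positivity
  have hsin : Real.sin (Real.arcsin (min 1 (1 / |x|))) = min 1 (1 / |x|) :=
    Real.sin_arcsin (by linarith) (min_le_left _ _)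
  refine ⟨Real.arcsin (min 1 (1 / |x|)), ⟨(Real.arcsin_pos.mpr hpos).le, ?_⟩, ?_⟩
  · linarith [Real.arcsin_le_pi_div_two (min 1 (1 / |x|)), Real.pi_pos]
  · have harg : |x * min 1 (1 / |x|)| ≤ 1 := by
      rw [abs_mul, abs_of_pos hpos]
      calc |x| * min 1 (1 / |x|) ≤ |x| * (1 / |x|) := by gcongr; exact min_le_right _ _
        _ = 1 := mul_one_div_cancel (abs_ne_zero.mpr hx)
    obtain ⟨hge, hle⟩ := abs_le.mp harg
    rw [hsin]
    refine (Real.cos_le_one _).lt_of_ne fun h => mul_ne_zero hx hpos.ne' ?_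
    have := Real.pi_gt_three
    exact (Real.cos_eq_one_iff_of_lt_of_lt (by linarith) (by linarith)).mp h

theorem abs_besselJ_zero_lt_one {x : ℝ} (hx : x ≠ 0) : |besselJ 0 x| < 1 := by
  have hcont : Continuous fun θ => Real.cos (x * Real.sin θ) := by fun_prop
  have hupper : ∫ θ in (0 : ℝ)..Real.pi, Real.cos (x * Real.sin θ) <
      ∫ _ in (0 : ℝ)..Real.pi, (1 : ℝ) :=
    intervalIntegral.integral_lt_integral_of_continuousOn_of_le_of_exists_lt Real.pi_pos
      hcont.continuousOn continuousOn_const (fun θ _ => Real.cos_le_one _)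
      (exists_cos_mul_sin_lt_one hx)
  have hlower : ∫ _ in (0 : ℝ)..Real.pi, (-1 : ℝ) <
      ∫ θ in (0 : ℝ)..Real.pi, Real.cos (x * Real.sin θ) :=
    intervalIntegral.integral_lt_integral_of_continuousOn_of_le_of_exists_lt Real.pi_pos
      continuousOn_const hcont.continuousOn (fun θ _ => Real.neg_one_le_cos _)
      ⟨0, ⟨le_rfl, Real.pi_pos.le⟩, by simp⟩
  rw [← pi_mul_besselJ_zero, intervalIntegral.integral_const, smul_eq_mul, sub_zero,
    mul_lt_mul_iff_right₀ Real.pi_pos] at hupper hlower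
  exact abs_lt.mpr ⟨hlower, hupper⟩

theorem abs_portCorrelation_lt_one {lam d : ℝ} (hlam : lam ≠ 0) (hd : d ≠ 0) :
    |portCorrelation lam d| < 1 :=
  abs_besselJ_zero_lt_one (by positivity)

theorem measure_pi_forall_ne {κ : Type*} [Fintype κ] [DecidableEq κ] {α : κ → Type*}
    [∀ n, MeasurableSpace (α n)] (μ : ∀ n, Measure (α n)) [∀ n, SigmaFinite (μ n)] (i : κ)
    {A : Set (α i)} (hA : MeasurableSet A) {B : ∀ n, Set (α i × α n)}
    (hB : ∀ n, MeasurableSet (B n)) :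
    Measure.pi μ {v | v i ∈ A ∧ ∀ n, n ≠ i → (v i, v n) ∈ B n} =
      ∫⁻ u in A, ∏ n ∈ Finset.univ.erase i, μ n (Prod.mk u ⁻¹' B n) ∂μ i := by
  let T : Set ((∀ n : {n // n = i}, α n) × ∀ n : {n // n ≠ i}, α n) :=
    (fun p => p.1 ⟨i, rfl⟩) ⁻¹' A ∩
      ⋂ n : {n // n ≠ i}, (fun p => (p.1 ⟨i, rfl⟩, p.2 n)) ⁻¹' B n
  have hT : MeasurableSet T :=
    (hA.preimage (by fun_prop)).inter <| .iInter fun n => (hB n).preimage (by fun_prop)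
  have hsplit := (measurePreserving_piEquivPiSubtypeProd μ (· = i)).measure_preimage
    hT.nullMeasurableSet
  have hslice (y : ∀ n : {n // n = i}, α n) :
      Measure.pi (fun n : {n // n ≠ i} => μ n) (Prod.mk y ⁻¹' T) =
      A.indicator (fun u => ∏ n ∈ Finset.univ.erase i, μ n (Prod.mk u ⁻¹' B n)) (y ⟨i, rfl⟩) := by
    by_cases hy : y ⟨i, rfl⟩ ∈ A
    · have hbox : Prod.mk y ⁻¹' T =
          Set.univ.pi fun n : {n // n ≠ i} => Prod.mk (y ⟨i, rfl⟩) ⁻¹' B n := by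
        ext w
        simp [T, hy]
      rw [hbox, Measure.pi_pi, Set.indicator_of_mem hy]
      exact (Finset.prod_subtype (Finset.univ.erase i) (by simp)
        fun n => μ n (Prod.mk (y ⟨i, rfl⟩) ⁻¹' B n)).symm
    · have hempty : Prod.mk y ⁻¹' T = ∅ := by
        ext w
        simp [T, hy]
      rw [hempty, measure_empty, Set.indicator_of_notMem hy]
  have hunique := (measurePreserving_piUnique fun n : {n // n = i} => μ n).lintegral_comp_emb
    (MeasurableEquiv.measurableEmbedding _)
    (A.indicator fun u => ∏ n ∈ Finset.univ.erase i, μ n (Prod.mk u ⁻¹' B n))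
  have hset : {v | v i ∈ A ∧ ∀ n, n ≠ i → (v i, v n) ∈ B n} =
      MeasurableEquiv.piEquivPiSubtypeProd α (· = i) ⁻¹' T := by
    ext v
    simp [T, MeasurableEquiv.piEquivPiSubtypeProd, Equiv.piEquivPiSubtypeProd]
  rw [hset, hsplit, Measure.prod_apply hT, lintegral_congr hslice, ← lintegral_indicator hA]
  convert hunique <;> rfl

section AffineImage

variable {ι : Type*} [Fintype ι] [Nonempty ι] {v : ℝ≥0}

theorem map_sum_sq_pi_gaussianReal_zero (hv : v ≠ 0) :
    (Measure.pi fun _ : ι => gaussianReal 0 v).map (fun w => (∑ i, w i ^ 2) / (2 * v : ℝ)) =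
      gammaMeasure (Fintype.card ι / 2) 1 := by
  simpa [noncentralGamma_zero] using map_sum_sq_pi_gaussianReal (0 : ι → ℝ) hv

theorem pi_gaussianReal_sum_sq_mul_add_le (hv : v ≠ 0) {a : ℝ} (ha : a ≠ 0) (c : ι → ℝ) (x : ℝ) :
    (Measure.pi fun _ : ι => gaussianReal 0 v) {w | ∑ i, (a * w i + c i) ^ 2 ≤ x} =
      noncentralGamma (Fintype.card ι / 2) ((∑ i, c i ^ 2) / (2 * v * a ^ 2)).toNNReal
        (Set.Iic (x / (2 * v * a ^ 2))) := by
  obtain ⟨s, hs⟩ : ∃ s : ℝ≥0, (s : ℝ) = a ^ 2 := ⟨⟨a ^ 2, sq_nonneg a⟩, rfl⟩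
  have hs0 : s ≠ 0 := by
    rw [← NNReal.coe_ne_zero, hs]
    positivity
  have hsv : s * v ≠ 0 := mul_ne_zero hs0 hv
  have hscale : 2 * v * a ^ 2 = 2 * ((s * v : ℝ≥0) : ℝ) := by
    push_cast
    rw [hs]
    ring
  have hcoord (i : ι) : MeasurePreserving (fun y => a * y + c i)
      (gaussianReal 0 v) (gaussianReal (c i) (s * v)) := by
    refine ⟨by fun_prop, ?_⟩
    have h := congrArg (Measure.map (· + c i)) (gaussianReal_map_const_mul (μ := 0) (v := v) a)
    rw [Measure.map_map (by fun_prop) (by fun_prop), gaussianReal_map_add_const, mul_zero,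
      zero_add] at h
    rwa [← show (⟨a ^ 2, sq_nonneg a⟩ : ℝ≥0) = s from NNReal.eq hs.symm]
  have hpi := (measurePreserving_pi (fun _ : ι => gaussianReal 0 v) _ hcoord).measure_preimage
    (s := {w | ∑ i, w i ^ 2 ≤ x}) (measurableSet_le (by fun_prop) (by fun_prop)).nullMeasurableSet
  rw [hscale, ← map_sum_sq_pi_gaussianReal c hsv, Measure.map_apply (by fun_prop) measurableSet_Iic]
  refine hpi.trans (congrArg _ ?_)
  ext w
  simp [div_le_div_iff_of_pos_right (show 0 < 2 * ((s : ℝ) * v) by positivity)]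

theorem map_sum_sq_pi_gaussianReal_half :
    (Measure.pi fun _ : ι => gaussianReal 0 (1 / 2)).map (fun w => ∑ i, w i ^ 2) =
      gammaMeasure (Fintype.card ι / 2) 1 := by
  simpa using map_sum_sq_pi_gaussianReal_zero (ι := ι) (v := 1 / 2) (by norm_num)

theorem pi_gaussianReal_half_sum_sq_correlated_le {ρ : ℝ} (hρ : |ρ| < 1) (u : ι → ℝ) (x : ℝ) :
    (Measure.pi fun _ : ι => gaussianReal 0 (1 / 2))
        {w | ∑ i, (√(1 - ρ ^ 2) * w i + ρ * u i) ^ 2 ≤ x} =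
      noncentralGamma (Fintype.card ι / 2) ((∑ i, u i ^ 2) * ρ ^ 2 / (1 - ρ ^ 2)).toNNReal
        (Set.Iic (x / (1 - ρ ^ 2))) := by
  have hρ' : 0 < 1 - ρ ^ 2 := sub_pos.mpr ((sq_lt_one_iff_abs_lt_one ρ).mpr hρ)
  have h := pi_gaussianReal_sum_sq_mul_add_le (v := 1 / 2) (by norm_num)
    (Real.sqrt_pos.mpr hρ').ne' (fun i => ρ * u i) x
  simpa [Real.sq_sqrt hρ'.le, mul_pow, ← Finset.mul_sum, mul_comm] using h

end AffineImage

section Channel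

variable {Ω : Type*} {N m : ℕ}

/-- The `2m` real Gaussian coordinates of port `n`: the real parts `x_{n,k}` on the left summand,
the imaginary parts `y_{n,k}` on the right one. -/
def portVector (X Y : Fin N → Fin m → Ω → ℝ) (n : Fin N) (ω : Ω) : Fin m ⊕ Fin m → ℝ :=
  Sum.elim (fun k => X n k ω) fun k => Y n k ω

theorem hasLaw_portVector [MeasurableSpace Ω] {P : Measure Ω} {X Y : Fin N → Fin m → Ω → ℝ}
    {ν : Measure ℝ} [IsProbabilityMeasure ν]
    (hX : ∀ n k, HasLaw (X n k) ν P) (hY : ∀ n k, HasLaw (Y n k) ν P)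
    (hindep : iIndepFun
      (Sum.elim (fun p : Fin N × Fin m => X p.1 p.2) fun p : Fin N × Fin m => Y p.1 p.2) P) :
    HasLaw (fun ω n => portVector X Y n ω)
      (Measure.pi fun _ : Fin N => Measure.pi fun _ : Fin m ⊕ Fin m => ν) P := by
  let e : Fin N × (Fin m ⊕ Fin m) ≃ (Fin N × Fin m) ⊕ (Fin N × Fin m) :=
    Equiv.prodSumDistrib _ _ _
  have hlaw : ∀ p, HasLaw (Sum.elim (fun p : Fin N × Fin m => X p.1 p.2)
      (fun p : Fin N × Fin m => Y p.1 p.2) (e p)) ν P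
    | (n, .inl k) => hX n k
    | (n, .inr k) => hY n k
  have hjoint := (hindep.precomp e.injective).hasLaw_pi hlaw
  have hcurry : HasLaw (MeasurableEquiv.curry (Fin N) (Fin m ⊕ Fin m) ℝ)
      (Measure.pi fun _ : Fin N => Measure.pi fun _ : Fin m ⊕ Fin m => ν)
      (Measure.pi fun _ : Fin N × (Fin m ⊕ Fin m) => ν) := by
    refine ⟨(MeasurableEquiv.measurable _).aemeasurable, ?_⟩
    simpa only [Measure.infinitePi_eq_pi] using
      Measure.infinitePi_map_curry fun (_ : Fin N) (_ : Fin m ⊕ Fin m) => ν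
  refine (hcurry.comp hjoint).congr (ae_of_all _ fun ω => ?_)
  funext n k
  cases k <;> rfl

theorem norm_add_I_mul_sq (a b : ℝ) : ‖(a : ℂ) + Complex.I * b‖ ^ 2 = a ^ 2 + b ^ 2 := by
  rw [mul_comm, ← Complex.normSq_eq_norm_sq, Complex.normSq_add_mul_I]

variable [NeZero N] (ρ : Fin N → ℝ) (X Y : Fin N → Fin m → Ω → ℝ)

theorem portGain_zero (ω : Ω) : portGain ρ X Y 0 ω = ∑ i, portVector X Y 0 ω i ^ 2 := by
  simp [portGain, channel, portVector, norm_add_I_mul_sq, Finset.sum_add_distrib]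

theorem portGain_of_ne_zero {n : Fin N} (hn : n ≠ 0) (ω : Ω) :
    portGain ρ X Y n ω =
      ∑ i, (√(1 - ρ n ^ 2) * portVector X Y n ω i + ρ n * portVector X Y 0 ω i) ^ 2 := by
  simp only [portGain, channel, if_neg hn, portVector, norm_add_I_mul_sq, Fintype.sum_sum_type,
    Sum.elim_inl, Sum.elim_inr, Finset.sum_add_distrib]

theorem bestGain_le_iff (x : ℝ) (ω : Ω) :
    bestGain ρ X Y ω ≤ x ↔ ∑ i, portVector X Y 0 ω i ^ 2 ≤ x ∧ ∀ n, n ≠ 0 →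
      ∑ i, (√(1 - ρ n ^ 2) * portVector X Y n ω i + ρ n * portVector X Y 0 ω i) ^ 2 ≤ x := by
  have hall : bestGain ρ X Y ω ≤ x ↔ ∀ n, portGain ρ X Y n ω ≤ x :=
    (Finset.sup'_le_iff _ _).trans (by simp)
  rw [hall, ← portGain_zero ρ]
  refine ⟨fun h => ⟨h 0, fun n hn => portGain_of_ne_zero ρ X Y hn ω ▸ h n⟩, fun h n => ?_⟩
  obtain rfl | hn := eq_or_ne n 0
  · exact h.1
  · exact portGain_of_ne_zero ρ X Y hn ω ▸ h.2 n hn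

theorem bestGain_nonneg (ω : Ω) : 0 ≤ bestGain ρ X Y ω :=
  (Finset.sum_nonneg fun _ _ => sq_nonneg _).trans ((bestGain_le_iff ρ X Y _ ω).mp le_rfl).1

variable [MeasurableSpace Ω] {P : Measure Ω} {X Y}

theorem aemeasurable_bestGain (hX : ∀ n k, AEMeasurable (X n k) P)
    (hY : ∀ n k, AEMeasurable (Y n k) P) : AEMeasurable (bestGain ρ X Y) P := by
  have hgain (n : Fin N) : AEMeasurable (portGain ρ X Y n) P := by
    unfold portGain channel
    split_ifs <;> fun_prop
  have hsup : AEMeasurable (Finset.univ.sup' ⟨0, Finset.mem_univ _⟩ (portGain ρ X Y)) P :=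
    Finset.sup'_induction (p := (AEMeasurable · P)) _ _ (fun _ hf _ hg => hf.sup hg)
      fun n _ => hgain n
  exact hsup.congr (ae_of_all _ fun ω => Finset.sup'_apply _ _ ω)

theorem measure_bestGain_le {ν : Measure ℝ} [IsProbabilityMeasure ν]
    (hX : ∀ n k, HasLaw (X n k) ν P) (hY : ∀ n k, HasLaw (Y n k) ν P)
    (hindep : iIndepFun
      (Sum.elim (fun p : Fin N × Fin m => X p.1 p.2) fun p : Fin N × Fin m => Y p.1 p.2) P)
    (x : ℝ) :
    P {ω | bestGain ρ X Y ω ≤ x} =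
      ∫⁻ u in {u | ∑ i, u i ^ 2 ≤ x}, ∏ n ∈ Finset.univ.erase 0,
        Measure.pi (fun _ : Fin m ⊕ Fin m => ν)
          {w | ∑ i, (√(1 - ρ n ^ 2) * w i + ρ n * u i) ^ 2 ≤ x}
        ∂Measure.pi fun _ : Fin m ⊕ Fin m => ν := by
  have hA : MeasurableSet {u : Fin m ⊕ Fin m → ℝ | ∑ i, u i ^ 2 ≤ x} :=
    measurableSet_le (by fun_prop) measurable_const
  have hB (n : Fin N) : MeasurableSet {p : (Fin m ⊕ Fin m → ℝ) × (Fin m ⊕ Fin m → ℝ) |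
      ∑ i, (√(1 - ρ n ^ 2) * p.2 i + ρ n * p.1 i) ^ 2 ≤ x} :=
    measurableSet_le (by fun_prop) measurable_const
  simp_rw [bestGain_le_iff]
  refine ((hasLaw_portVector hX hY hindep).measure_eq ?_).trans
    (measure_pi_forall_ne (fun _ : Fin N => Measure.pi fun _ : Fin m ⊕ Fin m => ν) 0 hA hB)
  simp only [Set.ofPred_and, Set.ofPred_forall]
  exact (hA.preimage (measurable_pi_apply 0)).inter <| .iInter fun n => .iInter fun _ =>
    (hB n).preimage (f := fun v : Fin N → Fin m ⊕ Fin m → ℝ => (v 0, v n)) (by fun_prop)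

variable {ρ}

theorem measure_bestGain_le_eq_lintegral_noncentralGamma (hm : 1 ≤ m)
    (hX : ∀ n k, HasLaw (X n k) (gaussianReal 0 (1 / 2)) P)
    (hY : ∀ n k, HasLaw (Y n k) (gaussianReal 0 (1 / 2)) P)
    (hindep : iIndepFun
      (Sum.elim (fun p : Fin N × Fin m => X p.1 p.2) fun p : Fin N × Fin m => Y p.1 p.2) P)
    (hρ : ∀ n, n ≠ 0 → |ρ n| < 1) (x : ℝ) :
    P {ω | bestGain ρ X Y ω ≤ x} = ∫⁻ z in Set.Iic x, ∏ n ∈ Finset.univ.erase 0,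
      noncentralGamma m (z * ρ n ^ 2 / (1 - ρ n ^ 2)).toNNReal (Set.Iic (x / (1 - ρ n ^ 2)))
        ∂gammaMeasure m 1 := by
  have : NeZero m := ⟨by omega⟩
  have hcard : (Fintype.card (Fin m ⊕ Fin m) / 2 : ℝ) = m := by simp
  have hreference := map_sum_sq_pi_gaussianReal_half (ι := Fin m ⊕ Fin m)
  have hport (u : Fin m ⊕ Fin m → ℝ) (n : Fin N) (hn : n ≠ 0) :=
    pi_gaussianReal_half_sum_sq_correlated_le (hρ n hn) u x
  rw [hcard] at hreference
  simp_rw [hcard] at hport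
  rw [measure_bestGain_le ρ hX hY hindep, ← hreference,
    setLIntegral_map measurableSet_Iic ?_ (by fun_prop)]
  · exact lintegral_congr fun u => Finset.prod_congr rfl fun n hn =>
      hport u n (Finset.ne_of_mem_erase hn)
  · exact Finset.measurable_prod _ fun n _ =>
      (measurable_noncentralGamma_apply m measurableSet_Iic).fun_comp (by fun_prop)

variable [IsProbabilityMeasure P]

theorem cdf_bestGain_of_nonneg (hm : 1 ≤ m)
    (hX : ∀ n k, HasLaw (X n k) (gaussianReal 0 (1 / 2)) P)
    (hY : ∀ n k, HasLaw (Y n k) (gaussianReal 0 (1 / 2)) P)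
    (hindep : iIndepFun
      (Sum.elim (fun p : Fin N × Fin m => X p.1 p.2) fun p : Fin N × Fin m => Y p.1 p.2) P)
    (hρ : ∀ n, n ≠ 0 → |ρ n| < 1) {x : ℝ} (hx : 0 ≤ x) :
    cdf (P.map (bestGain ρ X Y)) x =
      1 / Real.Gamma m * ∫ z in (0 : ℝ)..x, Real.exp (-z) * z ^ (m - 1) *
        ∏ n ∈ Finset.univ.erase (0 : Fin N), phi m (ρ n) z x := by
  have hmeas := aemeasurable_bestGain ρ (fun n k => (hX n k).aemeasurable)
    fun n k => (hY n k).aemeasurable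
  have := Measure.isProbabilityMeasure_map hmeas
  rw [cdf_eq_real, map_measureReal_apply_of_aemeasurable hmeas measurableSet_Iic]
  change (P {ω | bestGain ρ X Y ω ≤ x}).toReal = _
  have hfin (n : Fin N) (z : ℝ) : noncentralGamma m (z * ρ n ^ 2 / (1 - ρ n ^ 2)).toNNReal
      (Set.Iic (x / (1 - ρ n ^ 2))) < ∞ :=
    have := isProbabilityMeasure_noncentralGamma (Nat.cast_pos.mpr hm)
      (z * ρ n ^ 2 / (1 - ρ n ^ 2)).toNNReal
    measure_lt_top _ _
  rw [measure_bestGain_le_eq_lintegral_noncentralGamma hm hX hY hindep hρ, ← integral_toReal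
    (Finset.measurable_prod _ fun n _ =>
      (measurable_noncentralGamma_apply m measurableSet_Iic).fun_comp (by fun_prop)).aemeasurable
    (ae_of_all _ fun z => ENNReal.prod_lt_top fun n _ => hfin n z),
    setIntegral_Iic_gammaMeasure_natCast_one hm _ hx]
  congr 1
  refine intervalIntegral.integral_congr fun z hz => congrArg _ ?_
  rw [Set.uIcc_of_le hx] at hz
  rw [ENNReal.toReal_prod]
  exact Finset.prod_congr rfl fun n hn =>
    (phi_eq_noncentralGamma_real_Iic hm (hρ n (Finset.ne_of_mem_erase hn)) hz.1 hx).symm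

theorem cdf_bestGain_of_neg (hX : ∀ n k, AEMeasurable (X n k) P)
    (hY : ∀ n k, AEMeasurable (Y n k) P) {x : ℝ} (hx : x < 0) :
    cdf (P.map (bestGain ρ X Y)) x = 0 := by
  have hmeas := aemeasurable_bestGain ρ hX hY
  have := Measure.isProbabilityMeasure_map hmeas
  have hempty : bestGain ρ X Y ⁻¹' Set.Iic x = ∅ :=
    Set.eq_empty_of_forall_notMem fun ω hω => (hx.trans_le (bestGain_nonneg ρ X Y ω)).not_ge hω
  rw [cdf_eq_real, map_measureReal_apply_of_aemeasurable hmeas measurableSet_Iic, hempty,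
    measureReal_empty]

end Channel

end FluidAntenna

theorem theorem1 {Ω : Type*} [MeasurableSpace Ω] (P : Measure Ω) [IsProbabilityMeasure P]
    (N m : ℕ) [NeZero N] (hm : 1 ≤ m)
    (X Y : Fin N → Fin m → Ω → ℝ)
    (hX : ∀ n k, HasLaw (X n k) (gaussianReal 0 (1 / 2)) P)
    (hY : ∀ n k, HasLaw (Y n k) (gaussianReal 0 (1 / 2)) P)
    (hindep : iIndepFun
      (Sum.elim (fun p : Fin N × Fin m => X p.1 p.2) (fun p : Fin N × Fin m => Y p.1 p.2)) P) :
    (∀ ρ : Fin N → ℝ, (∀ n, n ≠ 0 → |ρ n| < 1) →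
      (∀ x : ℝ, x < 0 → cdf (P.map (FluidAntenna.bestGain ρ X Y)) x = 0) ∧
      (∀ x : ℝ, 0 ≤ x → cdf (P.map (FluidAntenna.bestGain ρ X Y)) x =
        1 / Real.Gamma m * ∫ z in (0 : ℝ)..x, Real.exp (-z) * z ^ (m - 1) *
          ∏ n ∈ Finset.univ.erase (0 : Fin N), FluidAntenna.phi m (ρ n) z x)) ∧
    (∀ (lam : ℝ) (d ρ : Fin N → ℝ), 0 < lam → (∀ n, n ≠ 0 → 0 < d n) →
      (∀ n, ρ n = FluidAntenna.portCorrelation lam (d n)) →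
      (∀ n, n ≠ 0 → |ρ n| < 1) ∧
      (∀ x : ℝ, x < 0 → cdf (P.map (FluidAntenna.bestGain ρ X Y)) x = 0) ∧
      (∀ x : ℝ, 0 ≤ x → cdf (P.map (FluidAntenna.bestGain ρ X Y)) x =
        1 / Real.Gamma m * ∫ z in (0 : ℝ)..x, Real.exp (-z) * z ^ (m - 1) *
          ∏ n ∈ Finset.univ.erase (0 : Fin N), FluidAntenna.phi m (ρ n) z x)) := by
  have formula (ρ : Fin N → ℝ) (hρ : ∀ n, n ≠ 0 → |ρ n| < 1) :=
    And.intro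
      (fun (x : ℝ) (hx : x < 0) => FluidAntenna.cdf_bestGain_of_neg (ρ := ρ)
        (fun n k => (hX n k).aemeasurable) (fun n k => (hY n k).aemeasurable) hx)
      (fun (x : ℝ) (hx : 0 ≤ x) =>
        FluidAntenna.cdf_bestGain_of_nonneg hm hX hY hindep hρ hx)
  refine ⟨formula, fun lam d ρ hlam hd hρ => ?_⟩
  have hlt : ∀ n, n ≠ 0 → |ρ n| < 1 := fun n hn =>
    hρ n ▸ FluidAntenna.abs_portCorrelation_lt_one hlam.ne' (hd n hn).ne'
  exact ⟨hlt, formula ρ hlt⟩
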